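/- **Setting.** There are $n$ items $[n]=\{1,\dots,n\}$, $n>2$, and a fixed subset size $k$ with $1\le k\le n$. A *Plackett–Luce (PL) instance* is a score vector $\theta=(\theta_1,\dots,\theta_n)$ with pairwise distinct entries in $(0,1]$ and $\max_i\theta_i=1$ (the items need not be labelled in the order of their scores). For $\emptyset\ne S\subseteq[n]$ and $i\in S$ put $\Pr_\theta(i\mid S)=\theta_i/\sum_{j\in S}\theta_j$. A (possibly randomized) sequential algorithm with winner (WI) feedback chooses in each round, on the basis of the past, either to play a set $S_t\subseteq[n]$ with $|S_t|=k$, whereupon it observes an item $I_t\in S_t$ drawn with probability $\Pr_\theta(\cdot\mid S_t)$, or to stop and output a ranking $\sigma$, a bijection $[n]\to[n]$ that maps each item to its position. Its *sample complexity* on $\theta$ is the expected number of rounds played before it stops. A ranking $\sigma$ is *$\epsilon$-Best-Ranking-Multiplicative* for $\theta$ if there are no items $i,j$ with $\sigma(i)>\sigma(j)$ and $\Pr_\theta(i\mid\{i,j\})\ge\frac12+\epsilon$. An algorithm is *$(\epsilon,\delta)$-PAC-Rank-Multiplicative* if on every PL instance it stops after finitely many rounds with probability $1$ and its output is $\epsilon$-Best-Ranking-Multiplicative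 with probability at least $1-\delta$. It is *symmetric* if for every PL instance $\theta$, every bijection $\phi:[n]\to[n]$ and every ranking $\sigma$, the probability that it outputs $\sigma$ on $\theta$ equals the probability that it outputs $\sigma\circ\phi$ on $(\theta_{\phi(1)},\dots,\theta_{\phi(n)})$. **Theorem.** For every $\delta_0<1$ there is a constant $c>0$, depending only on $\delta_0$, such that the following holds for all $n\ge 3$ with $n!\,(1-\delta_0)>1$, all $1\le k\le n$, all $\epsilon\in(0,1/\sqrt8]$ and all $\delta\in[0,\delta_0]$. For every symmetric $(\epsilon,\delta)$-PAC-Rank-Multiplicative algorithm $\mathcal A$ with WI feedback from $k$-subsets there is a PL instance $\nu$ such that the sample complexity of $\mathcal A$ on $\nu$ is at least $$c\,\frac{n}{\epsilon^2}\,\ln\frac{n}{4\delta},$$ where the bound is read as $+\infty$ if $\delta=0$. (For $\delta_0=\tfrac12$ the condition $n!\,(1-\delta_0)>1$ holds for all $n\ge3$, so $c$ is then an absolute constant for all $n\ge 3$ and $\delta\in[0,\frac12]$.) -/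

import Mathlib

open scoped ENNReal Nat

noncomputable section

namespace PLRank

/-- The score vectors of the Plackett-Luce instances on `n` items: scores in `(0, 1]`, pairwise
distinct, with largest score `1`. The items need not be labelled in the order of their scores. -/
structure IsInstance {n : ℕ} (θ : Fin n → ℝ) : Prop where
  pos : ∀ i, 0 < θ i
  le_one : ∀ i, θ i ≤ 1
  exists_eq_one : ∃ i, θ i = 1
  injective : Function.Injective θ

/-- `Pr(i | S)`: the Plackett-Luce probability that `i` wins in the set `S`. -/
def winProb {n : ℕ} (θ : Fin n → ℝ) (S : Finset (Fin n)) (i : Fin n) : ℝ :=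
  if i ∈ S then θ i / ∑ j ∈ S, θ j else 0

/-- A ranking `σ` sends each item to its position. It is an `ε`-best ranking in the
multiplicative sense if no item `i` is placed after an item `j` that it beats with probability
at least `1 / 2 + ε`. -/
def IsBestRankingMult {n : ℕ} (ε : ℝ) (θ : Fin n → ℝ) (σ : Equiv.Perm (Fin n)) : Prop :=
  ¬ ∃ i j : Fin n, σ j < σ i ∧ 1 / 2 + ε ≤ winProb θ {i, j} i

/-- The subsets of exactly `k` items. -/
abbrev KSubset (n k : ℕ) : Type := {S : Finset (Fin n) // S.card = k}

/-- The rounds played so far, each a played set with its observed winner, latest round first. -/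
abbrev History (n k : ℕ) : Type := List (KSubset n k × Fin n)

/-- A randomized sequential ranking algorithm with winner feedback from `k`-subsets: given the
history, it draws either the next `k`-subset to play (`Sum.inl`), or the ranking that it outputs
when it stops (`Sum.inr`). -/
structure WIAlgorithm (n k : ℕ) where
  policy : History n k → PMF (KSubset n k ⊕ Equiv.Perm (Fin n))

namespace WIAlgorithm

variable {n k : ℕ}

/-- The probability that the first `h.length` rounds are played and produce the history `h`. -/
def historyProb (A : WIAlgorithm n k) (θ : Fin n → ℝ) : History n k → ℝ≥0∞
  | [] => 1
  | (S, i) :: h =>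
      historyProb A θ h * A.policy h (Sum.inl S) * ENNReal.ofReal (winProb θ S.1 i)

/-- The probability that the history is `h` and the algorithm then stops and outputs `σ`. -/
def stopProb (A : WIAlgorithm n k) (θ : Fin n → ℝ) (h : History n k)
    (σ : Equiv.Perm (Fin n)) : ℝ≥0∞ :=
  A.historyProb θ h * A.policy h (Sum.inr σ)

/-- The probability that the algorithm stops after finitely many rounds with an output in `E`. -/
def outputProb (A : WIAlgorithm n k) (θ : Fin n → ℝ) (E : Set (Equiv.Perm (Fin n))) : ℝ≥0∞ :=
  ∑' (h : History n k) (σ : E), A.stopProb θ h σ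

/-- The expected number of rounds played; the second summand is infinite if the algorithm
fails to stop with positive probability, and zero otherwise. -/
def sampleComplexity (A : WIAlgorithm n k) (θ : Fin n → ℝ) : ℝ≥0∞ :=
  (∑' (h : History n k) (σ : Equiv.Perm (Fin n)), (h.length : ℝ≥0∞) * A.stopProb θ h σ)
    + ⊤ * (1 - A.outputProb θ Set.univ)

/-- `(ε, δ)`-PAC-Rank-Multiplicative: on each instance the algorithm stops almost surely, and
its output is an `ε`-best ranking in the multiplicative sense with probability at least `1 - δ`. -/
def IsPACRankMult (A : WIAlgorithm n k) (ε δ : ℝ) : Prop :=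
  ∀ θ : Fin n → ℝ, IsInstance θ →
    A.outputProb θ Set.univ = 1 ∧
    ENNReal.ofReal (1 - δ) ≤ A.outputProb θ {σ | IsBestRankingMult ε θ σ}

/-- Label invariance. In the instance `θ ∘ ρ` the item `i` has the score that the item `ρ i` has
in `θ`, so the ranking `σ` of the items of `θ` corresponds to the ranking `σ ∘ ρ`. -/
def IsSymmetric (A : WIAlgorithm n k) : Prop :=
  ∀ θ : Fin n → ℝ, IsInstance θ → ∀ ρ σ : Equiv.Perm (Fin n),
    A.outputProb θ {σ} = A.outputProb (θ ∘ ρ) {σ * ρ}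

end WIAlgorithm

end PLRank

end

/-! Take two levels of nearly equal scores, with half of the items in each and a gap that forces
every acceptable ranking to list the upper level first. Exchanging one upper and one lower item
gives N = ⌊n/2⌋⌈n/2⌉ ≥ n²/6 alternative instances. Each item is moved by at most n of them, each
time by O(ε), and the normalisation of the choice probabilities cancels the set size. So, whatever k
is, one round carries divergence O(nε²) summed over all alternatives (`sum_winProb_mul_log_le`,
`sum_levelPairs_sq_le`).

A change of measure (`WIAlgorithm.change_of_measure`) bounds the sum over the alternatives P' of
λP(E) - (e^λ - 1)P'(E) by this divergence times the expected number of rounds τ. The events that the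
instance and its alternatives require are pairwise disjoint, so on one instance those of the
alternatives have total probability at most δ. Averaging over all relabellings turns this into a
bound on the sum of the P'(E). With λ = ln(N/δ) the result is N((1-δ)ln(N/δ) - 1) ≤ O(nε²)τ, hence a
bound of order (n/ε²)ln(n/(4δ)) once ln(N/δ) ≥ 2/(1-δ₀) makes the -1 harmless.

Otherwise n is bounded in terms of δ₀ and order 1/ε² suffices. For geometric scores a single ranking
is acceptable; some ranking is output with probability at most 1/n!, and a relabelling makes that
ranking the required one, of probability at least 1-δ₀ > 1/n!. For δ = 0, the two-level bound holds
on one instance for all δ' in (0, 1], which forces τ = ∞. -/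

noncomputable section

namespace PLRank

/-! ### Sums over histories by length, and choice probabilities -/

/-- The lists of length `m` over a finite type. -/
def listsOfLength (X : Type*) [Fintype X] : ℕ → Finset (List X)
  | 0 => {[]}
  | m + 1 => (Finset.univ ×ˢ listsOfLength X m).map
      ⟨fun p : X × List X => p.1 :: p.2, fun p q h => by
        simp only [List.cons.injEq] at h
        exact Prod.ext h.1 h.2⟩

theorem mem_listsOfLength {X : Type*} [Fintype X] (m : ℕ) (l : List X) :
    l ∈ listsOfLength X m ↔ l.length = m := by
  induction m generalizing l with
  | zero => simp [listsOfLength]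
  | succ m ih =>
    cases l with
    | nil => simp [listsOfLength]
    | cons x l =>
      rw [listsOfLength, Finset.mem_map]
      constructor
      · rintro ⟨⟨y, l'⟩, hp, he⟩
        obtain ⟨rfl, rfl⟩ := List.cons.inj he
        simpa [ih] using hp
      · intro hl
        exact ⟨(x, l), by simpa [ih] using hl, rfl⟩

theorem sum_listsOfLength_succ {X : Type*} [Fintype X] {M : Type*} [AddCommMonoid M] (m : ℕ)
    (F : List X → M) :
    ∑ l ∈ listsOfLength X (m + 1), F l = ∑ l ∈ listsOfLength X m, ∑ x, F (x :: l) := by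
  rw [listsOfLength, Finset.sum_map, Finset.sum_product, Finset.sum_comm]
  rfl

/-- There are finitely many histories of each length, so grouping by length leaves a single series,
over the number of rounds, with finite sums inside. -/
theorem tsum_list_eq_tsum_listsOfLength {X : Type*} [Fintype X] (F : List X → ℝ≥0∞) :
    ∑' l, F l = ∑' m, ∑ l ∈ listsOfLength X m, F l := by
  rw [← (Equiv.sigmaFiberEquiv (List.length (α := X))).tsum_eq F, ENNReal.tsum_sigma']
  refine tsum_congr fun m => ?_
  rw [← Finset.tsum_subtype]
  refine (Equiv.subtypeEquivRight fun l => ?_).tsum_eq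
    (fun l : {l // l ∈ listsOfLength X m} => F l)
  exact (mem_listsOfLength m l).symm

theorem winProb_nonneg {n : ℕ} {θ : Fin n → ℝ} (hθ : ∀ i, 0 < θ i) (S : Finset (Fin n))
    (i : Fin n) : 0 ≤ winProb θ S i := by
  unfold winProb
  split_ifs
  · exact div_nonneg (hθ i).le (Finset.sum_nonneg fun j _ => (hθ j).le)
  · exact le_rfl

theorem sum_pos_of_mem {n : ℕ} {θ : Fin n → ℝ} (hθ : ∀ i, 0 < θ i) {S : Finset (Fin n)}
    {i : Fin n} (hi : i ∈ S) : 0 < ∑ j ∈ S, θ j :=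
  Finset.sum_pos (fun j _ => hθ j) ⟨i, hi⟩

theorem winProb_pos {n : ℕ} {θ : Fin n → ℝ} (hθ : ∀ i, 0 < θ i) {S : Finset (Fin n)}
    {i : Fin n} (hi : i ∈ S) : 0 < winProb θ S i := by
  rw [winProb, if_pos hi]
  exact div_pos (hθ i) (sum_pos_of_mem hθ hi)

theorem sum_winProb {n : ℕ} {θ : Fin n → ℝ} (hθ : ∀ i, 0 < θ i) {S : Finset (Fin n)}
    (hS : S.Nonempty) : ∑ i, winProb θ S i = 1 := by
  obtain ⟨i, hi⟩ := hS
  simp only [winProb]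
  rw [Finset.sum_ite_mem, Finset.univ_inter, ← Finset.sum_div,
    div_self (sum_pos_of_mem hθ hi).ne']

/-! ### Truncated runs and optional stopping -/

namespace WIAlgorithm

variable {n k : ℕ}

theorem historyProb_ne_top (A : WIAlgorithm n k) (θ : Fin n → ℝ) (h : History n k) :
    A.historyProb θ h ≠ ⊤ := by
  induction h with
  | nil => simp [historyProb]
  | cons x h ih =>
    obtain ⟨S, i⟩ := x
    exact ENNReal.mul_ne_top (ENNReal.mul_ne_top ih ((A.policy h).apply_ne_top _))
      ENNReal.ofReal_ne_top

/-- `historyProb` as a real number. -/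
def histReal (A : WIAlgorithm n k) (θ : Fin n → ℝ) (h : History n k) : ℝ :=
  (A.historyProb θ h).toReal

/-- `stopProb` as a real number. -/
def stopReal (A : WIAlgorithm n k) (θ : Fin n → ℝ) (h : History n k)
    (σ : Equiv.Perm (Fin n)) : ℝ :=
  (A.stopProb θ h σ).toReal

theorem histReal_nonneg (A : WIAlgorithm n k) (θ : Fin n → ℝ) (h : History n k) :
    0 ≤ A.histReal θ h := ENNReal.toReal_nonneg

theorem stopReal_nonneg (A : WIAlgorithm n k) (θ : Fin n → ℝ) (h : History n k)
    (σ : Equiv.Perm (Fin n)) : 0 ≤ A.stopReal θ h σ := ENNReal.toReal_nonneg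

theorem stopReal_eq (A : WIAlgorithm n k) (θ : Fin n → ℝ) (h : History n k)
    (σ : Equiv.Perm (Fin n)) :
    A.stopReal θ h σ = A.histReal θ h * (A.policy h (Sum.inr σ)).toReal :=
  ENNReal.toReal_mul

theorem histReal_nil (A : WIAlgorithm n k) (θ : Fin n → ℝ) : A.histReal θ [] = 1 := by
  simp [histReal, historyProb]

theorem histReal_cons (A : WIAlgorithm n k) {θ : Fin n → ℝ} (hθ : ∀ i, 0 < θ i)
    (S : KSubset n k) (i : Fin n) (h : History n k) :
    A.histReal θ ((S, i) :: h)
      = A.histReal θ h * (A.policy h (Sum.inl S)).toReal * winProb θ S.1 i := by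
  simp [histReal, historyProb, ENNReal.toReal_mul, ENNReal.toReal_ofReal (winProb_nonneg hθ _ _)]

theorem sum_policy (A : WIAlgorithm n k) (h : History n k) :
    ∑ S, (A.policy h (Sum.inl S)).toReal + ∑ σ, (A.policy h (Sum.inr σ)).toReal = 1 := by
  have h1 := (A.policy h).tsum_coe
  rw [tsum_fintype] at h1
  have h2 := congrArg ENNReal.toReal h1
  rw [ENNReal.toReal_sum fun x _ => (A.policy h).apply_ne_top x, Fintype.sum_sum_type] at h2
  simpa using h2

theorem sum_histReal_succ (A : WIAlgorithm n k) {θ : Fin n → ℝ} (hθ : ∀ i, 0 < θ i) (m : ℕ)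
    (F : History n k → ℝ) :
    ∑ h ∈ listsOfLength (KSubset n k × Fin n) (m + 1), A.histReal θ h * F h
      = ∑ h ∈ listsOfLength (KSubset n k × Fin n) m, A.histReal θ h *
          ∑ S, (A.policy h (Sum.inl S)).toReal * ∑ i, winProb θ S.1 i * F ((S, i) :: h) := by
  rw [sum_listsOfLength_succ]
  refine Finset.sum_congr rfl fun h _ => ?_
  rw [Fintype.sum_prod_type, Finset.mul_sum]
  refine Finset.sum_congr rfl fun S _ => ?_
  rw [Finset.mul_sum, Finset.mul_sum]
  refine Finset.sum_congr rfl fun i _ => ?_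
  rw [A.histReal_cons hθ]
  ring

/-- A function of the history that drifts downwards along the rounds has a nonpositive mean when
the run is truncated after `m` rounds. -/
theorem sum_stopReal_add_sum_histReal_le (A : WIAlgorithm n k) {θ : Fin n → ℝ}
    (hθ : ∀ i, 0 < θ i) (F : History n k → ℝ)
    (hF : ∀ (h : History n k) (S : KSubset n k),
      ∑ i, winProb θ S.1 i * F ((S, i) :: h) ≤ F h) (m : ℕ) :
    ∑ j ∈ Finset.range m, ∑ h ∈ listsOfLength (KSubset n k × Fin n) j,
        ∑ σ, A.stopReal θ h σ * F h
      + ∑ h ∈ listsOfLength (KSubset n k × Fin n) m, A.histReal θ h * F h ≤ F [] := by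
  induction m with
  | zero => simp [listsOfLength, histReal_nil]
  | succ m ih =>
    -- Each history that survives `m` rounds either stops there or plays one more set; the policy
    -- has total mass one, so the drift condition applies under the sum.
    refine le_trans ?_ ih
    rw [Finset.sum_range_succ, add_assoc]
    gcongr
    rw [A.sum_histReal_succ hθ, ← Finset.sum_add_distrib]
    refine Finset.sum_le_sum fun h _ => ?_
    have h1 : ∑ S, (A.policy h (Sum.inl S)).toReal * ∑ i, winProb θ S.1 i * F ((S, i) :: h)
        ≤ ∑ S, (A.policy h (Sum.inl S)).toReal * F h :=
      Finset.sum_le_sum fun S _ => mul_le_mul_of_nonneg_left (hF h S) ENNReal.toReal_nonneg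
    calc ∑ σ, A.stopReal θ h σ * F h + A.histReal θ h * _
        ≤ ∑ σ, A.stopReal θ h σ * F h
          + A.histReal θ h * ∑ S, (A.policy h (Sum.inl S)).toReal * F h := by
            have := mul_le_mul_of_nonneg_left h1 (A.histReal_nonneg θ h)
            linarith
      _ = A.histReal θ h * F h * (∑ S, (A.policy h (Sum.inl S)).toReal
            + ∑ σ, (A.policy h (Sum.inr σ)).toReal) := by
            simp only [A.stopReal_eq, mul_add, Finset.mul_sum]
            rw [add_comm]
            congr 1 <;> exact Finset.sum_congr rfl fun _ _ => by ring
      _ = _ := by rw [sum_policy, mul_one]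

theorem sum_stopReal_add_sum_histReal (A : WIAlgorithm n k) (hk : 1 ≤ k) {θ : Fin n → ℝ}
    (hθ : ∀ i, 0 < θ i) (m : ℕ) :
    ∑ j ∈ Finset.range m, ∑ h ∈ listsOfLength (KSubset n k × Fin n) j, ∑ σ, A.stopReal θ h σ
      + ∑ h ∈ listsOfLength (KSubset n k × Fin n) m, A.histReal θ h = 1 := by
  have hw : ∀ S : KSubset n k, ∑ i, winProb θ S.1 i = 1 := fun S =>
    sum_winProb hθ (Finset.card_pos.1 (by rw [S.2]; omega))
  -- The constants `1` and `-1` both have zero drift; the two inequalities give the equality.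
  have h1 := A.sum_stopReal_add_sum_histReal_le hθ (fun _ => 1)
    (fun h S => by simp [hw]) m
  have h2 := A.sum_stopReal_add_sum_histReal_le hθ (fun _ => -1)
    (fun h S => by simp [hw]) m
  simp only [mul_one, mul_neg, Finset.sum_neg_distrib] at h1 h2
  linarith

theorem hasSum_levels_of_tsum_ne_top (f : History n k → Equiv.Perm (Fin n) → ℝ≥0∞)
    (E : Set (Equiv.Perm (Fin n))) [DecidablePred (· ∈ E)]
    (hf : ∑' (h : History n k) (σ : E), f h σ ≠ ⊤) :
    HasSum (fun m => ∑ h ∈ listsOfLength (KSubset n k × Fin n) m,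
      ∑ σ, if σ ∈ E then (f h σ).toReal else 0) (∑' (h : History n k) (σ : E), f h σ).toReal := by
  have h0 : ∀ (h : History n k), ∀ σ : E, f h σ ≠ ⊤ := fun h σ =>
    ne_top_of_le_ne_top hf ((ENNReal.le_tsum σ).trans
      (ENNReal.le_tsum (f := fun h => ∑' σ : E, f h σ) h))
  have h1 : ∀ h : History n k, ∑' σ : E, f h σ = ∑ σ, if σ ∈ E then f h σ else 0 := by
    intro h
    rw [tsum_subtype E (f h), tsum_fintype]
    exact Finset.sum_congr rfl fun σ _ => by simp [Set.indicator_apply]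
  rw [tsum_list_eq_tsum_listsOfLength] at hf ⊢
  have h2 := ENNReal.hasSum_toReal hf
  rw [← ENNReal.tsum_toReal_eq fun m => ne_top_of_le_ne_top hf (ENNReal.le_tsum m)] at h2
  convert h2 using 2 with m
  have h3 : ∀ h : History n k, ∀ σ, (if σ ∈ E then f h σ else 0) ≠ ⊤ := by
    intro h σ
    split_ifs with hσ
    · exact h0 h ⟨σ, hσ⟩
    · simp
  rw [ENNReal.toReal_sum]
  · refine Finset.sum_congr rfl fun h _ => ?_
    rw [h1, ENNReal.toReal_sum fun σ _ => h3 h σ]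
    exact Finset.sum_congr rfl fun σ _ => by split_ifs <;> simp
  · intro h _
    rw [h1]
    exact ENNReal.sum_ne_top.2 fun σ _ => h3 h σ

end WIAlgorithm

/-- `m * P(T ≥ m)` is at most the tail of the series for the mean of `T`. This removes the boundary
term of a truncated run. -/
theorem tendsto_mul_tail_of_hasSum {p : ℕ → ℝ} {a τ : ℝ} (hp : ∀ j, 0 ≤ p j) (h1 : HasSum p a)
    (hτ : HasSum (fun j : ℕ => (j : ℝ) * p j) τ) :
    Filter.Tendsto (fun m : ℕ => (m : ℝ) * (a - ∑ j ∈ Finset.range m, p j)) Filter.atTop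
      (nhds 0) := by
  have ht : Filter.Tendsto (fun m : ℕ => τ - ∑ j ∈ Finset.range m, (j : ℝ) * p j) Filter.atTop
      (nhds 0) := by
    simpa using hτ.tendsto_sum_nat.const_sub τ
  refine squeeze_zero (fun m => ?_) (fun m => ?_) ht
  · exact mul_nonneg m.cast_nonneg (sub_nonneg.2 (sum_le_hasSum _ (fun j _ => hp j) h1))
  · refine hasSum_le (fun j => ?_) (((hasSum_nat_add_iff' m).2 h1).mul_left (m : ℝ))
      ((hasSum_nat_add_iff' m).2 hτ)
    have : (m : ℝ) ≤ ((j + m : ℕ) : ℝ) := by exact_mod_cast Nat.le_add_left m j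
    exact mul_le_mul_of_nonneg_right this (hp _)

/-! ### Likelihood ratios and the change of measure -/

/-- The log-likelihood ratio of a history under `θ` and `θ'`. -/
def logRatio {n k : ℕ} (θ θ' : Fin n → ℝ) (h : History n k) : ℝ :=
  (h.map fun x => Real.log (winProb θ x.1.1 x.2 / winProb θ' x.1.1 x.2)).sum

theorem winProb_mul_exp_neg_log {n : ℕ} {θ θ' : Fin n → ℝ} (hθ : ∀ i, 0 < θ i)
    (hθ' : ∀ i, 0 < θ' i) (S : Finset (Fin n)) (i : Fin n) :
    winProb θ S i * Real.exp (-Real.log (winProb θ S i / winProb θ' S i)) = winProb θ' S i := by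
  by_cases hi : i ∈ S
  · have h1 := winProb_pos hθ hi
    have h2 := winProb_pos hθ' hi
    rw [Real.exp_neg, Real.exp_log (div_pos h1 h2)]
    field_simp
  -- Outside `S` both probabilities vanish, so the default values of division and logarithm do no
  -- harm.
  · simp [winProb, hi]

namespace WIAlgorithm

variable {n k : ℕ}

theorem histReal_mul_exp_neg_logRatio (A : WIAlgorithm n k) {θ θ' : Fin n → ℝ}
    (hθ : ∀ i, 0 < θ i) (hθ' : ∀ i, 0 < θ' i) (h : History n k) :
    A.histReal θ h * Real.exp (-logRatio θ θ' h) = A.histReal θ' h := by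
  induction h with
  | nil => simp [histReal_nil, logRatio]
  | cons x h ih =>
    obtain ⟨S, i⟩ := x
    rw [A.histReal_cons hθ, A.histReal_cons hθ', ← ih, ← winProb_mul_exp_neg_log hθ hθ' S.1 i]
    simp only [logRatio, List.map_cons, List.sum_cons, neg_add, Real.exp_add]
    ring

theorem stopReal_mul_exp_neg_logRatio (A : WIAlgorithm n k) {θ θ' : Fin n → ℝ}
    (hθ : ∀ i, 0 < θ i) (hθ' : ∀ i, 0 < θ' i) (h : History n k) (σ : Equiv.Perm (Fin n)) :
    A.stopReal θ h σ * Real.exp (-logRatio θ θ' h) = A.stopReal θ' h σ := by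
  rw [stopReal_eq, stopReal_eq, ← A.histReal_mul_exp_neg_logRatio hθ hθ']
  ring

theorem outputProb_mono (A : WIAlgorithm n k) (θ : Fin n → ℝ) {E E' : Set (Equiv.Perm (Fin n))}
    (h : E ⊆ E') : A.outputProb θ E ≤ A.outputProb θ E' :=
  ENNReal.tsum_le_tsum fun l => ENNReal.tsum_mono_subtype (A.stopProb θ l) h

/-- `outputProb` as a real number. -/
def outReal (A : WIAlgorithm n k) (θ : Fin n → ℝ) (E : Set (Equiv.Perm (Fin n))) : ℝ :=
  (A.outputProb θ E).toReal

/-- The probability of stopping after exactly `m` rounds with an output in `E`. -/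
def levelProb (A : WIAlgorithm n k) (θ : Fin n → ℝ) (E : Set (Equiv.Perm (Fin n))) (m : ℕ) : ℝ :=
  open Classical in
  ∑ h ∈ listsOfLength (KSubset n k × Fin n) m, ∑ σ, if σ ∈ E then A.stopReal θ h σ else 0

theorem levelProb_nonneg (A : WIAlgorithm n k) (θ : Fin n → ℝ) (E : Set (Equiv.Perm (Fin n)))
    (m : ℕ) : 0 ≤ A.levelProb θ E m := by
  refine Finset.sum_nonneg fun h _ => Finset.sum_nonneg fun σ _ => ?_
  split_ifs
  · exact A.stopReal_nonneg θ h σ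
  · exact le_rfl

theorem levelProb_univ (A : WIAlgorithm n k) (θ : Fin n → ℝ) (m : ℕ) :
    A.levelProb θ Set.univ m
      = ∑ h ∈ listsOfLength (KSubset n k × Fin n) m, ∑ σ, A.stopReal θ h σ := by
  simp [levelProb]

theorem hasSum_levelProb (A : WIAlgorithm n k) {θ : Fin n → ℝ}
    (hout : A.outputProb θ Set.univ = 1) (E : Set (Equiv.Perm (Fin n))) :
    HasSum (A.levelProb θ E) (A.outReal θ E) := by
  classical
  refine (hasSum_levels_of_tsum_ne_top (A.stopProb θ) E ?_).congr_fun ?_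
  · exact ne_top_of_le_ne_top (by simp [hout]) (A.outputProb_mono θ (Set.subset_univ E))
  · intro m
    simp only [levelProb, stopReal]

theorem hasSum_mul_levelProb (A : WIAlgorithm n k) {θ : Fin n → ℝ}
    (hout : A.outputProb θ Set.univ = 1) (hfin : A.sampleComplexity θ ≠ ⊤) :
    HasSum (fun m : ℕ => (m : ℝ) * A.levelProb θ Set.univ m) (A.sampleComplexity θ).toReal := by
  classical
  have h1 : A.sampleComplexity θ = ∑' (h : History n k) (σ : (Set.univ : Set (Equiv.Perm (Fin n)))),
      (h.length : ℝ≥0∞) * A.stopProb θ h σ := by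
    rw [sampleComplexity, hout, tsub_self, mul_zero, add_zero]
    exact tsum_congr fun h =>
      (tsum_univ fun σ : Equiv.Perm (Fin n) => (h.length : ℝ≥0∞) * A.stopProb θ h σ).symm
  rw [h1] at hfin ⊢
  convert hasSum_levels_of_tsum_ne_top
    (fun h σ => (h.length : ℝ≥0∞) * A.stopProb θ h σ) Set.univ hfin using 2 with m
  rw [levelProb_univ, Finset.mul_sum]
  refine Finset.sum_congr rfl fun h hh => ?_
  rw [Finset.mul_sum]
  refine Finset.sum_congr rfl fun σ _ => ?_
  rw [mem_listsOfLength] at hh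
  simp [stopReal, hh]

theorem outReal_nonneg (A : WIAlgorithm n k) (θ : Fin n → ℝ) (E : Set (Equiv.Perm (Fin n))) :
    0 ≤ A.outReal θ E := ENNReal.toReal_nonneg

theorem outReal_univ (A : WIAlgorithm n k) {θ : Fin n → ℝ}
    (hout : A.outputProb θ Set.univ = 1) : A.outReal θ Set.univ = 1 := by
  simp [outReal, hout]

theorem sum_outReal_le_one (A : WIAlgorithm n k) {θ : Fin n → ℝ}
    (hout : A.outputProb θ Set.univ = 1) {J : Type*} (s : Finset J)
    (E : J → Set (Equiv.Perm (Fin n)))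
    (hE : ∀ i ∈ s, ∀ j ∈ s, i ≠ j → Disjoint (E i) (E j)) : ∑ j ∈ s, A.outReal θ (E j) ≤ 1 := by
  classical
  rw [← A.outReal_univ hout]
  refine hasSum_le (fun m => ?_) (hasSum_sum fun j _ => A.hasSum_levelProb hout (E j))
    (A.hasSum_levelProb hout Set.univ)
  rw [levelProb_univ]
  simp only [levelProb]
  rw [Finset.sum_comm]
  refine Finset.sum_le_sum fun h _ => ?_
  rw [Finset.sum_comm]
  refine Finset.sum_le_sum fun σ _ => ?_
  by_cases hσ : ∃ j ∈ s, σ ∈ E j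
  · obtain ⟨j, hj, hjσ⟩ := hσ
    rw [Finset.sum_eq_single_of_mem j hj]
    · simp [hjσ]
    · intro i hi hij
      rw [if_neg fun hiσ => Set.disjoint_left.1 (hE i hi j hj hij) hiσ hjσ]
  · push Not at hσ
    rw [Finset.sum_eq_zero fun j hj => if_neg (hσ j hj)]
    exact A.stopReal_nonneg θ h σ

/-- With `L` the log-likelihood ratio, multiply `t - L + 1 ≤ exp (t - L)` by the probability under
`θ`; the factor `exp (-L)` turns it into the one under `θ'`. -/
theorem stopReal_mul_add_one_le (A : WIAlgorithm n k) {θ θ' : Fin n → ℝ}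
    (hθ : ∀ i, 0 < θ i) (hθ' : ∀ i, 0 < θ' i) (h : History n k) (σ : Equiv.Perm (Fin n)) (t : ℝ) :
    A.stopReal θ h σ * (t + 1)
      ≤ A.stopReal θ h σ * logRatio θ θ' h + A.stopReal θ' h σ * Real.exp t := by
  have h1 := mul_le_mul_of_nonneg_left (Real.add_one_le_exp (t - logRatio θ θ' h))
    (A.stopReal_nonneg θ h σ)
  rw [sub_eq_neg_add t, Real.exp_add, ← mul_assoc, A.stopReal_mul_exp_neg_logRatio hθ hθ'] at h1
  linarith

/-- The pointwise inequality is used with `t = lam` for outputs in `E` and `t = 0` for the others.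
-/
theorem levelProb_change_of_measure (A : WIAlgorithm n k) {θ θ' : Fin n → ℝ}
    (hθ : ∀ i, 0 < θ i) (hθ' : ∀ i, 0 < θ' i) (E : Set (Equiv.Perm (Fin n))) (lam : ℝ) (m : ℕ) :
    lam * A.levelProb θ E m + A.levelProb θ Set.univ m
      ≤ ∑ h ∈ listsOfLength (KSubset n k × Fin n) m, ∑ σ, A.stopReal θ h σ * logRatio θ θ' h
        + (A.levelProb θ' Set.univ m + (Real.exp lam - 1) * A.levelProb θ' E m) := by
  classical
  rw [levelProb_univ, levelProb_univ]
  simp only [levelProb, Finset.mul_sum, ← Finset.sum_add_distrib]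
  refine Finset.sum_le_sum fun h _ => Finset.sum_le_sum fun σ _ => ?_
  split_ifs
  · have := A.stopReal_mul_add_one_le hθ hθ' h σ lam
    linarith
  · have := A.stopReal_mul_add_one_le hθ hθ' h σ 0
    rw [Real.exp_zero] at this
    linarith

/-- Wald's inequality for a truncated run: the accumulated reward minus `B` per round drifts
downwards. Runs not stopped by time `m` contribute an error of order `m * P(T ≥ m)`. -/
theorem sum_stopReal_mul_list_sum_le (A : WIAlgorithm n k) (hk : 1 ≤ k) {θ : Fin n → ℝ}
    (hθ : ∀ i, 0 < θ i) (f : KSubset n k × Fin n → ℝ) (B : ℝ)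
    (hf : ∀ S : KSubset n k, ∑ i, winProb θ S.1 i * f (S, i) ≤ B) :
    ∃ M : ℝ, ∀ m : ℕ,
      ∑ j ∈ Finset.range m, ∑ h ∈ listsOfLength (KSubset n k × Fin n) j,
          ∑ σ, A.stopReal θ h σ * (h.map f).sum
        ≤ B * ∑ j ∈ Finset.range m, (j : ℝ) * A.levelProb θ Set.univ j
          + M * (m * (1 - ∑ j ∈ Finset.range m, A.levelProb θ Set.univ j)) := by
  have hw : ∀ S : KSubset n k, ∑ i, winProb θ S.1 i = 1 := fun S =>
    sum_winProb hθ (Finset.card_pos.1 (by rw [S.2]; omega))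
  -- Any bound uniform in `x` would do, since its factor tends to zero when the mean is finite.
  set M : ℝ := ∑ x, |B - f x| with hM
  have hMx : ∀ x, B - f x ≤ M := fun x =>
    (le_abs_self _).trans (Finset.single_le_sum (f := fun x => |B - f x|)
      (fun _ _ => abs_nonneg _) (Finset.mem_univ x))
  have hlen : ∀ h : History n k, B * h.length - (h.map f).sum ≤ M * h.length := by
    intro h
    induction h with
    | nil => simp
    | cons x h ih =>
      have := hMx x
      simp only [List.map_cons, List.sum_cons, List.length_cons]
      push_cast
      linarith
  refine ⟨M, fun m => ?_⟩
  have key := A.sum_stopReal_add_sum_histReal_le hθ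
    (fun h => (h.map f).sum - B * h.length) (fun h S => by
      simp only [List.map_cons, List.sum_cons, List.length_cons]
      calc _ = ∑ i, winProb θ S.1 i * f (S, i)
            + (∑ i, winProb θ S.1 i) * ((h.map f).sum - B * (h.length + 1 : ℕ)) := by
            rw [Finset.sum_mul, ← Finset.sum_add_distrib]
            exact Finset.sum_congr rfl fun _ _ => by ring
        _ ≤ _ := by
            rw [hw]
            have := hf S
            push_cast
            linarith) m
  have hmass := A.sum_stopReal_add_sum_histReal hk hθ m
  have htail : ∑ h ∈ listsOfLength (KSubset n k × Fin n) m,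
      A.histReal θ h * (B * h.length - (h.map f).sum)
      ≤ M * (m * (1 - ∑ j ∈ Finset.range m, A.levelProb θ Set.univ j)) := by
    have : (1 - ∑ j ∈ Finset.range m, A.levelProb θ Set.univ j)
        = ∑ h ∈ listsOfLength (KSubset n k × Fin n) m, A.histReal θ h := by
      simp only [levelProb_univ]
      linarith
    rw [this, Finset.mul_sum, Finset.mul_sum]
    refine Finset.sum_le_sum fun h hh => ?_
    have h1 := mul_le_mul_of_nonneg_left (hlen h) (A.histReal_nonneg θ h)
    rw [mem_listsOfLength] at hh
    rw [hh] at h1 ⊢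
    linarith
  have hneg : ∑ h ∈ listsOfLength (KSubset n k × Fin n) m,
      A.histReal θ h * (B * h.length - (h.map f).sum)
      = -∑ h ∈ listsOfLength (KSubset n k × Fin n) m,
        A.histReal θ h * ((h.map f).sum - B * h.length) := by
    rw [← Finset.sum_neg_distrib]
    exact Finset.sum_congr rfl fun _ _ => by ring
  have hsplit : ∑ j ∈ Finset.range m, ∑ h ∈ listsOfLength (KSubset n k × Fin n) j,
        ∑ σ, A.stopReal θ h σ * ((h.map f).sum - B * h.length)
      = ∑ j ∈ Finset.range m, ∑ h ∈ listsOfLength (KSubset n k × Fin n) j,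
          ∑ σ, A.stopReal θ h σ * (h.map f).sum
        - B * ∑ j ∈ Finset.range m, (j : ℝ) * A.levelProb θ Set.univ j := by
    simp only [levelProb_univ, Finset.mul_sum, ← Finset.sum_sub_distrib]
    refine Finset.sum_congr rfl fun j _ => Finset.sum_congr rfl fun h hh =>
      Finset.sum_congr rfl fun σ _ => ?_
    rw [mem_listsOfLength] at hh
    rw [hh]
    ring
  rw [hsplit] at key
  simp only [List.map_nil, List.sum_nil, List.length_nil, Nat.cast_zero, mul_zero, sub_zero] at key
  linarith

/-- The change of measure inequality: the sample complexity on `θ` bounds from below how far the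
probability of `E` on `θ` can be from its probabilities on the alternatives `θ' j`. -/
theorem change_of_measure (A : WIAlgorithm n k) (hk : 1 ≤ k) {θ : Fin n → ℝ}
    (hθ : ∀ i, 0 < θ i) (hout : A.outputProb θ Set.univ = 1) (hfin : A.sampleComplexity θ ≠ ⊤)
    {J : Type*} (s : Finset J) (θ' : J → Fin n → ℝ) (hθ' : ∀ j i, 0 < θ' j i)
    (hout' : ∀ j, A.outputProb (θ' j) Set.univ = 1) (B : ℝ)
    (hB : ∀ S : KSubset n k, ∑ j ∈ s, ∑ i, winProb θ S.1 i *
      Real.log (winProb θ S.1 i / winProb (θ' j) S.1 i) ≤ B)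
    (E : Set (Equiv.Perm (Fin n))) (lam : ℝ) :
    s.card * lam * A.outReal θ E - (Real.exp lam - 1) * ∑ j ∈ s, A.outReal (θ' j) E
      ≤ B * (A.sampleComplexity θ).toReal := by
  set f : KSubset n k × Fin n → ℝ := fun x =>
    ∑ j ∈ s, Real.log (winProb θ x.1.1 x.2 / winProb (θ' j) x.1.1 x.2) with hf
  have hsum : ∀ h : History n k, ∑ j ∈ s, logRatio θ (θ' j) h = (h.map f).sum := by
    intro h
    induction h with
    | nil => simp [logRatio]
    | cons x h ih =>
      simp only [logRatio, List.map_cons, List.sum_cons, Finset.sum_add_distrib] at ih ⊢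
      rw [ih]
  obtain ⟨M, hM⟩ := A.sum_stopReal_mul_list_sum_le hk hθ f B (fun S => by
    refine le_trans (le_of_eq ?_) (hB S)
    rw [Finset.sum_comm]
    simp only [hf, Finset.mul_sum])
  have hτ := A.hasSum_mul_levelProb hout hfin
  have huniv := A.hasSum_levelProb hout Set.univ
  have hu1 := huniv
  rw [A.outReal_univ hout] at hu1
  have htail := tendsto_mul_tail_of_hasSum (A.levelProb_nonneg θ Set.univ) hu1 hτ
  -- The inequality for runs stopped before round `m`, where every sum is finite.
  have hlevel : ∀ m : ℕ, s.card * (lam * ∑ i ∈ Finset.range m, A.levelProb θ E i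
        + ∑ i ∈ Finset.range m, A.levelProb θ Set.univ i)
      ≤ (B * ∑ j ∈ Finset.range m, (j : ℝ) * A.levelProb θ Set.univ j
          + M * (m * (1 - ∑ j ∈ Finset.range m, A.levelProb θ Set.univ j)))
        + ∑ j ∈ s, (∑ i ∈ Finset.range m, A.levelProb (θ' j) Set.univ i
          + (Real.exp lam - 1) * ∑ i ∈ Finset.range m, A.levelProb (θ' j) E i) := by
    intro m
    refine le_trans ?_ (add_le_add_left (hM m) _)
    have h1 := Finset.sum_le_sum fun j (_ : j ∈ s) => Finset.sum_le_sum fun i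
      (_ : i ∈ Finset.range m) => A.levelProb_change_of_measure hθ (hθ' j) E lam i
    simp only [Finset.sum_add_distrib, Finset.sum_const, nsmul_eq_mul, ← Finset.mul_sum] at h1 ⊢
    refine (le_of_eq (by ring)).trans (h1.trans (le_of_eq ?_))
    congr 1
    rw [Finset.sum_comm]
    refine Finset.sum_congr rfl fun j _ => ?_
    rw [Finset.sum_comm]
    refine Finset.sum_congr rfl fun h _ => ?_
    rw [Finset.sum_comm]
    refine Finset.sum_congr rfl fun σ _ => ?_
    rw [← Finset.mul_sum, hsum]
  have hl := (((A.hasSum_levelProb hout E).tendsto_sum_nat.const_mul lam).add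
    hu1.tendsto_sum_nat).const_mul (s.card : ℝ)
  have hr := ((hτ.tendsto_sum_nat.const_mul B).add (htail.const_mul M)).add
    (tendsto_finsetSum s fun j _ =>
      ((A.hasSum_levelProb (hout' j) Set.univ).tendsto_sum_nat).add
        ((A.hasSum_levelProb (hout' j) E).tendsto_sum_nat.const_mul (Real.exp lam - 1)))
  -- In the limit the error term vanishes, and the total masses, all equal to one, cancel.
  have hfinal := le_of_tendsto_of_tendsto' hl hr hlevel
  simp only [A.outReal_univ (hout' _), Finset.sum_add_distrib, Finset.sum_const, nsmul_eq_mul,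
    ← Finset.mul_sum] at hfinal
  linarith

end WIAlgorithm

/-! ### Divergence of one round, and the score ratio that decides a pair -/

theorem IsInstance.comp_perm {n : ℕ} {β : Fin n → ℝ} (hβ : IsInstance β)
    (ρ : Equiv.Perm (Fin n)) : IsInstance (β ∘ ρ) where
  pos i := hβ.pos _
  le_one i := hβ.le_one _
  exists_eq_one := by
    obtain ⟨i, hi⟩ := hβ.exists_eq_one
    exact ⟨ρ.symm i, by simpa using hi⟩
  injective := hβ.injective.comp ρ.injective

/-- The Kullback-Leibler divergence of one round is at most the chi-squared divergence. -/
theorem sum_winProb_mul_log_le {n : ℕ} {θ θ' : Fin n → ℝ} {m : ℝ} (hm : 0 < m)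
    (hθ : ∀ i, m ≤ θ i) (hθ' : ∀ i, m ≤ θ' i) (hθ'1 : ∀ i, θ' i ≤ 1)
    {S : Finset (Fin n)} (hS : S.Nonempty) :
    ∑ i, winProb θ S i * Real.log (winProb θ S i / winProb θ' S i)
      ≤ (∑ i ∈ S, (θ i - θ' i) ^ 2) / (m ^ 3 * S.card) := by
  have hθ0 : ∀ i, 0 < θ i := fun i => hm.trans_le (hθ i)
  have hθ'0 : ∀ i, 0 < θ' i := fun i => hm.trans_le (hθ' i)
  set W := ∑ i ∈ S, θ i with hW
  set W' := ∑ i ∈ S, θ' i with hW'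
  set X := ∑ i ∈ S, (θ i - θ' i) ^ 2 / θ' i with hX
  have hk : (0 : ℝ) < S.card := by exact_mod_cast hS.card_pos
  have hWm : m * S.card ≤ W := by
    rw [mul_comm, ← nsmul_eq_mul]
    exact Finset.card_nsmul_le_sum _ _ _ fun i _ => hθ i
  have hW0 : 0 < W := (mul_pos hm hk).trans_le hWm
  have hW'1 : W' ≤ S.card := by
    rw [← mul_one (S.card : ℝ), ← nsmul_eq_mul]
    exact Finset.sum_le_card_nsmul _ _ _ fun i _ => hθ'1 i
  have hW'0 : 0 < W' := Finset.sum_pos (fun j _ => hθ'0 j) hS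
  have hX0 : 0 ≤ X := Finset.sum_nonneg fun i _ => div_nonneg (sq_nonneg _) (hθ'0 i).le
  have hXle : X ≤ (∑ i ∈ S, (θ i - θ' i) ^ 2) / m := by
    rw [Finset.sum_div]
    exact Finset.sum_le_sum fun i _ => div_le_div_of_nonneg_left (sq_nonneg _) hm (hθ' i)
  have hsq : ∑ i ∈ S, θ i ^ 2 / θ' i = 2 * W - W' + X := by
    rw [hW, hW', hX, Finset.mul_sum, ← Finset.sum_sub_distrib, ← Finset.sum_add_distrib]
    refine Finset.sum_congr rfl fun i _ => ?_
    have := (hθ'0 i).ne'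
    field_simp
    ring
  calc ∑ i, winProb θ S i * Real.log (winProb θ S i / winProb θ' S i)
      = ∑ i ∈ S, winProb θ S i * Real.log (winProb θ S i / winProb θ' S i) := by
        refine (Finset.sum_subset (Finset.subset_univ S) fun i _ hi => ?_).symm
        simp [winProb, hi]
    -- `log u ≤ u - 1` with `u` the ratio of the two choice probabilities.
    _ ≤ ∑ i ∈ S, (W' / W ^ 2 * (θ i ^ 2 / θ' i) - θ i / W) := by
        refine Finset.sum_le_sum fun i hi => ?_
        have h1 := winProb_pos hθ0 hi
        have h2 := winProb_pos hθ'0 hi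
        refine (mul_le_mul_of_nonneg_left (Real.log_le_sub_one_of_pos (div_pos h1 h2))
          h1.le).trans (le_of_eq ?_)
        simp only [winProb, if_pos hi, ← hW, ← hW']
        have := (hθ'0 i).ne'
        field_simp
    _ = (W' * X - (W - W') ^ 2) / W ^ 2 := by
        rw [Finset.sum_sub_distrib, ← Finset.mul_sum, hsq, ← Finset.sum_div, ← hW]
        field_simp
        ring
    -- The square is dropped. One factor `S.card` from `W'` against two from `W ^ 2` leaves the `1 /
    -- S.card` that makes the final bound independent of `k`.
    _ ≤ (S.card * ((∑ i ∈ S, (θ i - θ' i) ^ 2) / m)) / (m * S.card) ^ 2 := by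
        have h1 : W' * X ≤ S.card * ((∑ i ∈ S, (θ i - θ' i) ^ 2) / m) :=
          mul_le_mul hW'1 hXle hX0 hk.le
        refine div_le_div₀ (mul_nonneg hk.le (hX0.trans hXle)) ?_ (by positivity) (by gcongr)
        nlinarith [sq_nonneg (W - W')]
    _ = _ := by field_simp

/-- The ratio of two scores at which the winning probability is `1 / 2 + ε`. -/
def gapRatio (ε : ℝ) : ℝ := (1 - 2 * ε) / (1 + 2 * ε)

theorem gapRatio_lt_one {ε : ℝ} (h0 : 0 < ε) : gapRatio ε < 1 := by
  rw [gapRatio, div_lt_one (by linarith)]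
  linarith

/-- `1 / 7` is the value at `ε = 3 / 8`, a rational upper bound for `1 / √8`. -/
theorem le_gapRatio {ε : ℝ} (h0 : 0 < ε) (h1 : ε ≤ 3 / 8) : 1 / 7 ≤ gapRatio ε := by
  rw [gapRatio, div_le_div_iff₀ (by norm_num) (by linarith)]
  linarith

theorem one_sub_le_gapRatio {ε : ℝ} (h0 : 0 < ε) : 1 - 4 * ε ≤ gapRatio ε := by
  rw [gapRatio, le_div_iff₀ (by linarith)]
  nlinarith

theorem IsBestRankingMult.lt_of_le_gapRatio_mul {n : ℕ} {ε : ℝ} (h0 : 0 < ε) {θ : Fin n → ℝ}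
    (hθ : IsInstance θ) {σ : Equiv.Perm (Fin n)} (hσ : IsBestRankingMult ε θ σ) {i j : Fin n}
    (h : θ j ≤ gapRatio ε * θ i) : σ i < σ j := by
  have hi := hθ.pos i
  have hj := hθ.pos j
  have hij : i ≠ j := by
    rintro rfl
    have := mul_lt_mul_of_pos_right (gapRatio_lt_one h0) hi
    linarith
  refine lt_of_le_of_ne (not_lt.1 fun hlt => hσ ⟨i, j, hlt, ?_⟩) fun he => hij (σ.injective he)
  rw [winProb, if_pos (by simp), Finset.sum_pair hij, le_div_iff₀ (by linarith)]
  have h2 : (1 + 2 * ε) * θ j ≤ (1 - 2 * ε) * θ i := by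
    have h3 : (1 + 2 * ε) * gapRatio ε = 1 - 2 * ε := by
      rw [gapRatio, mul_div_cancel₀ _ (by linarith)]
    calc (1 + 2 * ε) * θ j ≤ (1 + 2 * ε) * (gapRatio ε * θ i) := by gcongr
      _ = _ := by rw [← mul_assoc, h3]
  nlinarith

theorem WIAlgorithm.IsPACRankMult.one_sub_le_outReal {n k : ℕ} {A : WIAlgorithm n k} {ε δ : ℝ}
    (hA : A.IsPACRankMult ε δ) {θ : Fin n → ℝ} (hθ : IsInstance θ)
    {E : Set (Equiv.Perm (Fin n))} (hE : ∀ σ, IsBestRankingMult ε θ σ → σ ∈ E) :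
    1 - δ ≤ A.outReal θ E := by
  have h := (hA θ hθ).2.trans (A.outputProb_mono θ (show {σ | IsBestRankingMult ε θ σ} ⊆ E from hE))
  exact (ENNReal.ofReal_le_iff_le_toReal (ne_top_of_le_ne_top (by simp [(hA θ hθ).1])
    (A.outputProb_mono θ (Set.subset_univ E)))).1 h

/-! ### Geometric scores: a bound of order `1 / ε ^ 2` for each fixed `n` -/

section Geometric

/-- Geometrically decreasing scores: every two items are to be ranked correctly. -/
def geometricScores (n : ℕ) (ε : ℝ) (i : Fin n) : ℝ := gapRatio ε ^ (i : ℕ)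

variable {n : ℕ} {ε : ℝ}

theorem geometricScores_isInstance (hn : 1 ≤ n) (h0 : 0 < ε) (h1 : ε ≤ 3 / 8) :
    IsInstance (geometricScores n ε) := by
  have hr := le_gapRatio h0 h1
  have hr0 : 0 < gapRatio ε := by linarith
  have hr1 := gapRatio_lt_one h0
  refine ⟨fun i => pow_pos hr0 _, fun i => pow_le_one₀ hr0.le hr1.le, ⟨⟨0, hn⟩, ?_⟩, ?_⟩
  · simp [geometricScores]
  · intro i j h
    exact Fin.ext ((pow_right_strictAnti₀ hr0 hr1).injective h)

theorem le_geometricScores (h0 : 0 < ε) (h1 : ε ≤ 3 / 8) (i : Fin n) :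
    (1 / 7) ^ n ≤ geometricScores n ε i := by
  have hr := le_gapRatio h0 h1
  calc (1 / 7 : ℝ) ^ n ≤ (1 / 7) ^ (i : ℕ) :=
        pow_le_pow_of_le_one (by norm_num) (by norm_num) i.2.le
    _ ≤ _ := pow_le_pow_left₀ (by norm_num) hr _

/-- Bernoulli's inequality. All scores lie within `4 * n * ε` of each other, so relabelled instances
are hard to tell apart. -/
theorem one_sub_le_geometricScores (h0 : 0 < ε) (h1 : ε ≤ 3 / 8) (i : Fin n) :
    1 - 4 * n * ε ≤ geometricScores n ε i := by
  have hr := le_gapRatio h0 h1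
  have hr' := one_sub_le_gapRatio h0
  have h := one_add_mul_le_pow (a := gapRatio ε - 1) (by linarith) (i : ℕ)
  rw [add_sub_cancel] at h
  refine le_trans ?_ h
  have h2 : ((i : ℕ) : ℝ) ≤ n := by exact_mod_cast i.2.le
  have h3 : (0 : ℝ) ≤ ((i : ℕ) : ℝ) := Nat.cast_nonneg _
  nlinarith [mul_le_mul_of_nonneg_left hr' h3, mul_le_mul_of_nonneg_right h2 h0.le]

theorem eq_of_isBestRankingMult_geometricScores (hn : 1 ≤ n) (h0 : 0 < ε) (h1 : ε ≤ 3 / 8)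
    {ρ σ : Equiv.Perm (Fin n)} (hσ : IsBestRankingMult ε (geometricScores n ε ∘ ρ) σ) :
    σ = ρ := by
  have hr := le_gapRatio h0 h1
  have hmono : StrictMono (ρ.symm.trans σ) := by
    intro x y hxy
    refine hσ.lt_of_le_gapRatio_mul h0 ((geometricScores_isInstance hn h0 h1).comp_perm ρ) ?_
    simp only [geometricScores, Function.comp, Equiv.apply_symm_apply, ← pow_succ']
    exact pow_le_pow_of_le_one (by linarith) (gapRatio_lt_one h0).le hxy
  -- A strictly increasing permutation of `Fin n` is the identity.
  have h2 : (ρ.symm.trans σ : Fin n → Fin n) = id := by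
    rw [← hmono.range_inj strictMono_id, (ρ.symm.trans σ).surjective.range_eq, Set.range_id]
  ext i
  have := congrFun h2 (ρ i)
  simp only [Equiv.trans_apply, Equiv.symm_apply_apply, id] at this
  rw [this]

/-- For each fixed number of items the sample complexity is at least of order `1 / ε ^ 2`. -/
theorem exists_sampleComplexity_ge_of_geometricScores {k : ℕ} (hn : 1 ≤ n) (hk : 1 ≤ k)
    (h0 : 0 < ε) (h1 : ε ≤ 3 / 8) {δ γ : ℝ} (hδ : 0 ≤ δ) (hγ : 0 ≤ γ)
    (hγδ : γ + 1 / (n ! : ℝ) ≤ 1 - δ)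
    {A : WIAlgorithm n k} (hA : A.IsPACRankMult ε δ) :
    ∃ ν : Fin n → ℝ, IsInstance ν ∧ (A.sampleComplexity ν ≠ ⊤ →
      γ ^ 2 / 4 ≤ (4 * n * ε) ^ 2 / ((1 / 7) ^ n) ^ 3 * (A.sampleComplexity ν).toReal) := by
  classical
  set β := geometricScores n ε with hβ
  have hinst : ∀ ρ : Equiv.Perm (Fin n), IsInstance (β ∘ ρ) := fun ρ =>
    (geometricScores_isInstance hn h0 h1).comp_perm ρ
  have hβ1 := geometricScores_isInstance hn h0 h1
  have hfac : (0 : ℝ) < n ! := by exact_mod_cast Nat.factorial_pos n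
  -- Pigeonhole over the `n !` possible outputs on `β`.
  obtain ⟨ρ, -, hρ⟩ : ∃ ρ ∈ (Finset.univ : Finset (Equiv.Perm (Fin n))),
      A.outReal β {ρ} ≤ 1 / (n ! : ℝ) := by
    refine Finset.exists_le_of_sum_le Finset.univ_nonempty ?_
    refine (A.sum_outReal_le_one (hA β hβ1).1 Finset.univ (fun ρ => {ρ}) ?_).trans ?_
    · intro i _ j _ hij
      exact Set.disjoint_singleton.2 hij
    · rw [Finset.sum_const, Finset.card_univ, Fintype.card_perm, Fintype.card_fin, nsmul_eq_mul,
        mul_one_div_cancel hfac.ne']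
  refine ⟨β ∘ ρ, hinst ρ, fun hfin => ?_⟩
  have hm : (0 : ℝ) < (1 / 7) ^ n := by positivity
  have key := A.change_of_measure hk (hinst ρ).pos (hA _ (hinst ρ)).1 hfin
    (Finset.univ : Finset Unit) (fun _ => β) (fun _ => hβ1.pos) (fun _ => (hA β hβ1).1)
    ((4 * n * ε) ^ 2 / ((1 / 7) ^ n) ^ 3) (fun S => by
      have hScard : (S.1.card : ℝ) = k := by rw [S.2]
      have hk0 : (0 : ℝ) < k := by exact_mod_cast hk
      have hSne : S.1.Nonempty := Finset.card_pos.1 (by rw [S.2]; omega)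
      simp only [Finset.univ_unique, Finset.sum_singleton]
      refine (sum_winProb_mul_log_le hm (fun i => le_geometricScores h0 h1 _)
        (fun i => le_geometricScores h0 h1 _) hβ1.le_one hSne).trans ?_
      rw [hScard, div_le_div_iff₀ (by positivity) (by positivity)]
      have : ∑ i ∈ S.1, ((β ∘ ρ) i - β i) ^ 2 ≤ k * (4 * n * ε) ^ 2 := by
        rw [← hScard, ← nsmul_eq_mul]
        refine Finset.sum_le_card_nsmul _ _ _ fun i _ => ?_
        refine sq_le_sq' ?_ ?_
        · have := one_sub_le_geometricScores h0 h1 (ρ i)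
          have := hβ1.le_one i
          simp only [Function.comp, hβ] at *
          linarith
        · have := one_sub_le_geometricScores h0 h1 i
          have := hβ1.le_one (ρ i)
          simp only [Function.comp, hβ] at *
          linarith
      calc _ ≤ k * (4 * n * ε) ^ 2 * ((1 / 7) ^ n) ^ 3 :=
            mul_le_mul_of_nonneg_right this (by positivity)
        _ = _ := by ring)
    {ρ} (γ / 2)
  refine le_trans ?_ key
  have hx := hA.one_sub_le_outReal (hinst ρ) (E := {ρ})
    fun σ hσ => eq_of_isBestRankingMult_geometricScores hn h0 h1 hσ
  have hfac1 : 0 < 1 / (n ! : ℝ) := by positivity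
  have hγ1 : γ ≤ 1 := by linarith
  -- With `l = γ / 2` and `y = 1 / n !`, the left side of `key` is at least `l * (γ + y) - (l + l ^
  -- 2) * y ≥ l * γ - l ^ 2 = γ ^ 2 / 4`.
  have hexp := (abs_le.1 (Real.abs_exp_sub_one_sub_id_le
    (x := γ / 2) (abs_le.2 ⟨by linarith, by linarith⟩))).2
  have hexp0 := Real.add_one_le_exp (γ / 2)
  simp only [Finset.univ_unique, Finset.sum_singleton, Finset.card_singleton, Nat.cast_one,
    one_mul]
  have hy1 : 1 / (n ! : ℝ) ≤ 1 := by linarith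
  have e1 : (Real.exp (γ / 2) - 1) * A.outReal β {ρ}
      ≤ (γ / 2 + (γ / 2) ^ 2) * (1 / (n ! : ℝ)) :=
    mul_le_mul (by linarith) hρ (A.outReal_nonneg _ _) (by positivity)
  have e2 : γ / 2 * (γ + 1 / (n ! : ℝ)) ≤ γ / 2 * A.outReal (β ∘ ρ) {ρ} :=
    mul_le_mul_of_nonneg_left (by linarith) (by linarith)
  have e3 : (γ / 2) ^ 2 * (1 / (n ! : ℝ)) ≤ (γ / 2) ^ 2 * 1 :=
    mul_le_mul_of_nonneg_left hy1 (sq_nonneg _)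
  nlinarith

end Geometric

/-! ### Two-level scores: the main bound -/

section TwoLevel

/-- Two levels of nearly equal scores, with a gap between the first half of the items and the
second half. -/
def twoLevelScores (n : ℕ) (ε : ℝ) (i : Fin n) : ℝ :=
  (1 - ε * ((i : ℕ) / n)) * if (i : ℕ) < n / 2 then 1 else gapRatio ε * (1 - ε)

variable {n : ℕ} {ε : ℝ}

theorem twoLevelScores_factor_mem (h0 : 0 < ε) (i : Fin n) :
    1 - ε ≤ 1 - ε * ((i : ℕ) / n) ∧ 1 - ε * ((i : ℕ) / n) ≤ 1 := by
  have hn : (0 : ℝ) < n := by exact_mod_cast i.pos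
  have h2 : ((i : ℕ) : ℝ) / n ≤ 1 := by
    rw [div_le_one hn]
    exact_mod_cast i.2.le
  have h3 : (0 : ℝ) ≤ ((i : ℕ) : ℝ) / n := by positivity
  constructor <;> nlinarith

/-- The extra factor `1 - ε` on the lower level absorbs the perturbation of the upper one, which
serves only to make the scores distinct. -/
theorem twoLevelScores_low_le (h0 : 0 < ε) (h1 : ε ≤ 3 / 8) {i j : Fin n}
    (hi : (i : ℕ) < n / 2) (hj : n / 2 ≤ (j : ℕ)) :
    twoLevelScores n ε j ≤ gapRatio ε * twoLevelScores n ε i := by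
  have hr := le_gapRatio h0 h1
  have hfi := twoLevelScores_factor_mem h0 i
  have hfj := twoLevelScores_factor_mem h0 j
  rw [twoLevelScores, twoLevelScores, if_pos hi, if_neg (not_lt.2 hj), mul_one]
  have h2 : 0 ≤ gapRatio ε * (1 - ε) := mul_nonneg (by linarith) (by linarith)
  calc _ ≤ 1 * (gapRatio ε * (1 - ε)) := mul_le_mul_of_nonneg_right hfj.2 h2
    _ = gapRatio ε * (1 - ε) := one_mul _
    _ ≤ _ := mul_le_mul_of_nonneg_left hfi.1 (by linarith)

theorem twoLevelScores_bounds (h0 : 0 < ε) (h1 : ε ≤ 3 / 8) (i : Fin n) :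
    1 / 20 ≤ twoLevelScores n ε i ∧ 1 - 6 * ε ≤ twoLevelScores n ε i
      ∧ twoLevelScores n ε i ≤ 1 := by
  have hr := le_gapRatio h0 h1
  have hr1 := gapRatio_lt_one h0
  have hr4 := one_sub_le_gapRatio h0
  obtain ⟨hf, hf1⟩ := twoLevelScores_factor_mem h0 i
  rw [twoLevelScores]
  set t := 1 - ε * ((i : ℕ) / n)
  set r := gapRatio ε
  split_ifs
  · refine ⟨?_, ?_, ?_⟩ <;> linarith
  · have hp : r * (1 - ε) * (1 - ε) ≤ t * (r * (1 - ε)) := by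
      rw [mul_comm t]
      exact mul_le_mul_of_nonneg_left hf (mul_nonneg (by linarith) (by linarith))
    -- At `ε = 3 / 8` this gives `1 / 7 * 25 / 64 > 1 / 20`.
    have hs : (5 / 8 : ℝ) * (5 / 8) ≤ (1 - ε) * (1 - ε) := by nlinarith
    have hs2 : 1 - 2 * ε ≤ (1 - ε) * (1 - ε) := by nlinarith
    have hs1 : (1 - ε) * (1 - ε) ≤ 1 := by nlinarith
    rw [mul_assoc] at hp
    refine ⟨by nlinarith, ?_, ?_⟩
    · nlinarith
    · exact mul_le_one₀ hf1 (mul_nonneg (by linarith) (by linarith))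
        (mul_le_one₀ hr1.le (by linarith) (by linarith))

theorem twoLevelScores_isInstance (hn : 2 ≤ n) (h0 : 0 < ε) (h1 : ε ≤ 3 / 8) :
    IsInstance (twoLevelScores n ε) := by
  have hb := fun i : Fin n => twoLevelScores_bounds h0 h1 i
  have hr := le_gapRatio h0 h1
  have hr1 := gapRatio_lt_one h0
  have hn0 : (0 : ℝ) < n := by exact_mod_cast (by omega : 0 < n)
  refine ⟨fun i => by linarith [hb i], fun i => (hb i).2.2, ⟨⟨0, by omega⟩, ?_⟩, ?_⟩
  · rw [twoLevelScores, if_pos (by simp; omega)]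
    simp
  · have hne : ∀ i j : Fin n, (i : ℕ) < n / 2 → n / 2 ≤ (j : ℕ) →
        twoLevelScores n ε i ≠ twoLevelScores n ε j := by
      intro i j hi hj h
      have h2 := twoLevelScores_low_le h0 h1 hi hj
      rw [← h] at h2
      have := hb i
      nlinarith
    have hfac : ∀ (i j : Fin n) (c : ℝ), 0 < c →
        (1 - ε * ((i : ℕ) / n)) * c = (1 - ε * ((j : ℕ) / n)) * c → i = j := by
      intro i j c hc h
      have h2 := mul_right_cancel₀ hc.ne' h
      have h3 : ε * (((i : ℕ) : ℝ) / n) = ε * (((j : ℕ) : ℝ) / n) := by linarith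
      have h4 := mul_left_cancel₀ h0.ne' h3
      rw [div_left_inj' hn0.ne'] at h4
      exact Fin.ext (by exact_mod_cast h4)
    intro i j h
    by_cases hi : (i : ℕ) < n / 2 <;> by_cases hj : (j : ℕ) < n / 2
    · rw [twoLevelScores, twoLevelScores, if_pos hi, if_pos hj] at h
      exact hfac i j 1 one_pos h
    · exact absurd h (hne i j hi (not_lt.1 hj))
    · exact absurd h.symm (hne j i hj (not_lt.1 hi))
    · rw [twoLevelScores, twoLevelScores, if_neg hi, if_neg hj] at h
      exact hfac i j _ (mul_pos (by linarith) (by linarith)) h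

/-- The rankings that put the items of the upper level, as labelled by `ρ`, first. -/
def upperFirst (ρ : Equiv.Perm (Fin n)) : Set (Equiv.Perm (Fin n)) :=
  {σ | ∀ i j, (ρ i : ℕ) < n / 2 → n / 2 ≤ (ρ j : ℕ) → σ i < σ j}

/-- The pairs of an index of the upper level and an index of the lower level. -/
def levelPairs (n : ℕ) : Finset (Fin n × Fin n) :=
  (Finset.univ.filter fun u : Fin n => (u : ℕ) < n / 2) ×ˢ
    (Finset.univ.filter fun v : Fin n => n / 2 ≤ (v : ℕ))

theorem card_filter_upper (n : ℕ) :
    (Finset.univ.filter fun u : Fin n => (u : ℕ) < n / 2).card = n / 2 := by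
  rw [Fin.card_filter_val_lt]
  omega

theorem card_filter_lower (n : ℕ) :
    (Finset.univ.filter fun v : Fin n => n / 2 ≤ (v : ℕ)).card = n - n / 2 := by
  have h := Finset.card_filter_add_card_filter_not (s := (Finset.univ : Finset (Fin n)))
    (fun u : Fin n => (u : ℕ) < n / 2)
  rw [card_filter_upper, Finset.card_univ, Fintype.card_fin] at h
  simp only [not_lt] at h
  omega

theorem card_levelPairs (n : ℕ) : (levelPairs n).card = n / 2 * (n - n / 2) := by
  rw [levelPairs, Finset.card_product, card_filter_upper, card_filter_lower]

theorem mem_levelPairs {p : Fin n × Fin n} :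
    p ∈ levelPairs n ↔ (p.1 : ℕ) < n / 2 ∧ n / 2 ≤ (p.2 : ℕ) := by
  simp [levelPairs]

theorem disjoint_upperFirst {ρ ρ' : Equiv.Perm (Fin n)} {i j : Fin n}
    (hi : (ρ i : ℕ) < n / 2) (hj : n / 2 ≤ (ρ j : ℕ)) (hi' : n / 2 ≤ (ρ' i : ℕ))
    (hj' : (ρ' j : ℕ) < n / 2) : Disjoint (upperFirst ρ) (upperFirst ρ') :=
  Set.disjoint_left.2 fun _ h h' => lt_asymm (h i j hi hj) (h' j i hj' hi')

theorem disjoint_upperFirst_swap {p : Fin n × Fin n} (hp : p ∈ levelPairs n)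
    (ρ : Equiv.Perm (Fin n)) :
    Disjoint (upperFirst ρ) (upperFirst (Equiv.swap p.1 p.2 * ρ)) := by
  rw [mem_levelPairs] at hp
  refine disjoint_upperFirst (i := ρ.symm p.1) (j := ρ.symm p.2) ?_ ?_ ?_ ?_ <;> simp [hp.1, hp.2]

/-- Two different exchanges differ in the upper or in the lower index. The two items concerned then
lie on opposite levels, in opposite order, after the two exchanges. -/
theorem disjoint_upperFirst_swap_swap {p p' : Fin n × Fin n} (hp : p ∈ levelPairs n)
    (hp' : p' ∈ levelPairs n) (hne : p ≠ p') (ρ : Equiv.Perm (Fin n)) :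
    Disjoint (upperFirst (Equiv.swap p.1 p.2 * ρ)) (upperFirst (Equiv.swap p'.1 p'.2 * ρ)) := by
  obtain ⟨u, v⟩ := p
  obtain ⟨u', v'⟩ := p'
  simp only [mem_levelPairs] at hp hp'
  obtain ⟨hu, hv⟩ := hp
  obtain ⟨hu', hv'⟩ := hp'
  have huv : u ≠ v := fun h => by subst h; omega
  have huv' : u ≠ v' := fun h => by subst h; omega
  have hu'v : u' ≠ v := fun h => by subst h; omega
  have hu'v' : u' ≠ v' := fun h => by subst h; omega
  by_cases hvv : v = v'
  · have huu : u ≠ u' := fun h => hne (by rw [h, hvv])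
    refine disjoint_upperFirst (i := ρ.symm u') (j := ρ.symm u) ?_ ?_ ?_ ?_
    · simpa [Equiv.swap_apply_of_ne_of_ne huu.symm hu'v] using hu'
    · simpa using hv
    · simpa using hv'
    · simpa [Equiv.swap_apply_of_ne_of_ne huu huv'] using hu
  · refine disjoint_upperFirst (i := ρ.symm v) (j := ρ.symm v') ?_ ?_ ?_ ?_
    · simpa using hu
    · simpa [Equiv.swap_apply_of_ne_of_ne huv'.symm (Ne.symm hvv)] using hv'
    · simpa [Equiv.swap_apply_of_ne_of_ne hu'v.symm hvv] using hv
    · simpa using hu'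

theorem sum_levelPairs_sq_le (h0 : 0 < ε) (h1 : ε ≤ 3 / 8) (ρ : Equiv.Perm (Fin n))
    (S : Finset (Fin n)) :
    ∑ p ∈ levelPairs n, ∑ i ∈ S, ((twoLevelScores n ε ∘ ρ) i
        - (twoLevelScores n ε ∘ ⇑(Equiv.swap p.1 p.2 * ρ)) i) ^ 2
      ≤ S.card * (n * (6 * ε) ^ 2) := by
  classical
  have hb := fun i : Fin n => twoLevelScores_bounds h0 h1 i
  have hsq : ∀ i j : Fin n, (twoLevelScores n ε i - twoLevelScores n ε j) ^ 2 ≤ (6 * ε) ^ 2 :=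
    fun i j => sq_le_sq' (by linarith [hb i, hb j]) (by linarith [hb i, hb j])
  rw [Finset.sum_comm, ← nsmul_eq_mul]
  refine Finset.sum_le_card_nsmul _ _ _ fun i _ => ?_
  simp only [Function.comp, Equiv.Perm.mul_apply]
  set x := ρ i
  have hterm : ∀ p ∈ levelPairs n,
      (twoLevelScores n ε x - twoLevelScores n ε (Equiv.swap p.1 p.2 x)) ^ 2
        ≤ if p.1 = x ∨ p.2 = x then (6 * ε) ^ 2 else 0 := by
    intro p _
    split_ifs with h
    · exact hsq _ _
    · push Not at h
      rw [Equiv.swap_apply_of_ne_of_ne h.1.symm h.2.symm, sub_self]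
      norm_num
  refine (Finset.sum_le_sum hterm).trans ?_
  rw [← Finset.sum_filter, Finset.sum_const, nsmul_eq_mul]
  refine mul_le_mul_of_nonneg_right ?_ (sq_nonneg _)
  have hcard : ((levelPairs n).filter fun p => p.1 = x ∨ p.2 = x).card ≤ n := by
    -- The levels are disjoint, so `x` is always the same coordinate of the pair, and the other
    -- coordinate determines the pair.
    have hinj : Set.InjOn (fun p : Fin n × Fin n => if p.1 = x then p.2 else p.1)
        ((levelPairs n).filter fun p => p.1 = x ∨ p.2 = x) := by
      rintro ⟨u, v⟩ hp ⟨u', v'⟩ hp' h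
      simp only [Finset.coe_filter, mem_levelPairs, Set.mem_ofPred_eq] at hp hp' h
      ext <;> grind
    simpa using Finset.card_le_card_of_injOn _ (fun _ _ => Finset.mem_univ _) hinj
  exact_mod_cast hcard

/-- The lower bound from two levels of scores. -/
theorem exists_sampleComplexity_ge_of_twoLevelScores {k : ℕ} (hn : 3 ≤ n) (hk : 1 ≤ k)
    (h0 : 0 < ε) (h1 : ε ≤ 3 / 8) (A : WIAlgorithm n k)
    (hout : ∀ θ : Fin n → ℝ, IsInstance θ → A.outputProb θ Set.univ = 1) :
    ∃ ν : Fin n → ℝ, IsInstance ν ∧ (A.sampleComplexity ν ≠ ⊤ →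
      ∀ δ : ℝ, 0 < δ → δ ≤ 1 → A.IsPACRankMult ε δ →
        (levelPairs n).card * ((1 - δ) * Real.log ((levelPairs n).card / δ) - 1)
          ≤ 288000 * (n * ε ^ 2) * (A.sampleComplexity ν).toReal) := by
  classical
  set β := twoLevelScores n ε with hβ
  have hβ1 : IsInstance β := twoLevelScores_isInstance (by omega) h0 h1
  have hinst : ∀ ρ : Equiv.Perm (Fin n), IsInstance (β ∘ ρ) := fun ρ => hβ1.comp_perm ρ
  -- The worst labelling bounds the sample complexity of all labellings, and it is chosen before
  -- `δ`.
  obtain ⟨ρ₀, -, hmax⟩ := Finset.exists_max_image (Finset.univ : Finset (Equiv.Perm (Fin n)))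
    (fun ρ => A.sampleComplexity (β ∘ ρ)) Finset.univ_nonempty
  refine ⟨β ∘ ρ₀, hinst ρ₀, fun hfin δ hδ hδ1 hA => ?_⟩
  set N : ℝ := ((levelPairs n).card : ℝ) with hN
  set τ := (A.sampleComplexity (β ∘ ρ₀)).toReal with hτ
  have hN1 : 1 ≤ N := by
    rw [hN, card_levelPairs]
    exact_mod_cast Nat.mul_pos (by omega) (by omega)
  have hNδ : 1 ≤ N / δ := by
    rw [le_div_iff₀ hδ]
    linarith
  set x := Real.log (N / δ) with hx
  have hx0 : 0 ≤ x := Real.log_nonneg hNδ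
  have hexp : Real.exp x = N / δ := Real.exp_log (by linarith)
  have hB0 : 0 ≤ 288000 * (n * ε ^ 2) := by positivity
  have key : ∀ ρ : Equiv.Perm (Fin n), N * x * A.outReal (β ∘ ρ) (upperFirst ρ)
      - (N / δ - 1) * ∑ p ∈ levelPairs n,
          A.outReal (β ∘ ⇑(Equiv.swap p.1 p.2 * ρ)) (upperFirst ρ)
      ≤ 288000 * (n * ε ^ 2) * τ := by
    intro ρ
    rw [← hexp]
    refine (A.change_of_measure hk (hinst ρ).pos (hout _ (hinst ρ))
      (ne_top_of_le_ne_top hfin (hmax ρ (Finset.mem_univ ρ))) (levelPairs n)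
      (fun p => β ∘ ⇑(Equiv.swap p.1 p.2 * ρ)) (fun p => (hinst (Equiv.swap p.1 p.2 * ρ)).pos)
      (fun p => hout _ (hinst (Equiv.swap p.1 p.2 * ρ))) (288000 * (n * ε ^ 2)) (fun S => ?_) _ x).trans ?_
    · have hSne : S.1.Nonempty := Finset.card_pos.1 (by rw [S.2]; omega)
      have hk0 : (0 : ℝ) < S.1.card := by exact_mod_cast hSne.card_pos
      refine (Finset.sum_le_sum fun p _ => sum_winProb_mul_log_le (m := 1 / 20) (by norm_num)
        (fun i => (twoLevelScores_bounds h0 h1 _).1) (fun i => (twoLevelScores_bounds h0 h1 _).1)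
        (fun i => (twoLevelScores_bounds h0 h1 _).2.2) hSne).trans ?_
      rw [← Finset.sum_div, div_le_iff₀ (by positivity)]
      refine (sum_levelPairs_sq_le h0 h1 ρ S.1).trans (le_of_eq ?_)
      ring
    · exact mul_le_mul_of_nonneg_left (ENNReal.toReal_mono hfin (hmax ρ (Finset.mem_univ ρ))) hB0
  have hcorrect : ∀ ρ : Equiv.Perm (Fin n), 1 - δ ≤ A.outReal (β ∘ ρ) (upperFirst ρ) := fun ρ =>
    hA.one_sub_le_outReal (hinst ρ) fun σ hσ i j hi hj =>
      hσ.lt_of_le_gapRatio_mul h0 (hinst ρ) (twoLevelScores_low_le h0 h1 hi hj)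
  have hwrong : ∀ ρ : Equiv.Perm (Fin n), ∑ p ∈ levelPairs n,
      A.outReal (β ∘ ρ) (upperFirst (Equiv.swap p.1 p.2 * ρ)) ≤ δ := by
    intro ρ
    -- `none` stands for the correct event, which already takes mass `1 - δ`.
    have h := A.sum_outReal_le_one (hout _ (hinst ρ)) (Finset.insertNone (levelPairs n))
      (fun o => o.elim (upperFirst ρ) fun p => upperFirst (Equiv.swap p.1 p.2 * ρ)) (by
        rintro (_ | p) hp (_ | p') hp' hne
        · exact absurd rfl hne
        · exact disjoint_upperFirst_swap (Finset.some_mem_insertNone.1 hp') ρ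
        · exact (disjoint_upperFirst_swap (Finset.some_mem_insertNone.1 hp) ρ).symm
        · exact disjoint_upperFirst_swap_swap (Finset.some_mem_insertNone.1 hp)
            (Finset.some_mem_insertNone.1 hp') (fun h => hne (by rw [h])) ρ)
    rw [Finset.sum_insertNone] at h
    simp only [Option.elim] at h
    have := hcorrect ρ
    linarith
  -- For fixed `p`, left multiplication by the exchange is an involution on the labellings, so the
  -- instance and the event trade places.
  have hswap : ∑ ρ : Equiv.Perm (Fin n), ∑ p ∈ levelPairs n,
        A.outReal (β ∘ ⇑(Equiv.swap p.1 p.2 * ρ)) (upperFirst ρ)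
      = ∑ ρ : Equiv.Perm (Fin n), ∑ p ∈ levelPairs n,
        A.outReal (β ∘ ρ) (upperFirst (Equiv.swap p.1 p.2 * ρ)) := by
    rw [Finset.sum_comm, Finset.sum_comm (s := Finset.univ)]
    refine Finset.sum_congr rfl fun p _ => ?_
    rw [← Equiv.sum_comp (Equiv.mulLeft (Equiv.swap p.1 p.2))]
    refine Finset.sum_congr rfl fun ρ _ => ?_
    rw [Equiv.coe_mulLeft, ← mul_assoc, Equiv.swap_mul_self, one_mul]
  have hsum := Finset.sum_le_sum fun ρ (_ : ρ ∈ (Finset.univ : Finset (Equiv.Perm (Fin n)))) =>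
    key ρ
  rw [Finset.sum_sub_distrib, ← Finset.mul_sum, ← Finset.mul_sum, hswap, Finset.sum_const,
    nsmul_eq_mul] at hsum
  have h2 : (Finset.univ : Finset (Equiv.Perm (Fin n))).card * (1 - δ)
      ≤ ∑ ρ : Equiv.Perm (Fin n), A.outReal (β ∘ ρ) (upperFirst ρ) := by
    rw [← nsmul_eq_mul]
    exact Finset.card_nsmul_le_sum _ _ _ fun ρ _ => hcorrect ρ
  have h3 : ∑ ρ : Equiv.Perm (Fin n), ∑ p ∈ levelPairs n,
        A.outReal (β ∘ ρ) (upperFirst (Equiv.swap p.1 p.2 * ρ))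
      ≤ (Finset.univ : Finset (Equiv.Perm (Fin n))).card * δ := by
    rw [← nsmul_eq_mul]
    exact Finset.sum_le_card_nsmul _ _ _ fun ρ _ => hwrong ρ
  have hF : (0 : ℝ) < (Finset.univ : Finset (Equiv.Perm (Fin n))).card := by
    exact_mod_cast Finset.univ_nonempty.card_pos
  set F : ℝ := ((Finset.univ : Finset (Equiv.Perm (Fin n))).card : ℝ)
  have h4 := mul_le_mul_of_nonneg_left h2 (by positivity : 0 ≤ N * x)
  have h5 := mul_le_mul_of_nonneg_left h3 (by linarith : 0 ≤ N / δ - 1)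
  -- Here `exp x = N / δ` pays off: the wrong outputs cost less than `N` per labelling.
  have h6 : (N / δ - 1) * (F * δ) = F * (N - δ) := by
    field_simp
  refine le_of_mul_le_mul_left ?_ hF
  have h7 : 0 ≤ F * δ := by positivity
  nlinarith

end TwoLevel

/-! ### Zero error, small `n`, and the choice of the constant -/

theorem sq_le_card_levelPairs {n : ℕ} (hn : 3 ≤ n) :
    (n : ℝ) ^ 2 / 6 ≤ (levelPairs n).card ∧ (n : ℝ) / 4 ≤ (levelPairs n).card := by
  rw [card_levelPairs]
  obtain ⟨q, hq⟩ : ∃ q, q = n / 2 := ⟨_, rfl⟩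
  rw [← hq, Nat.cast_mul, Nat.cast_sub (by omega)]
  have h1 : (2 * q : ℝ) ≤ n := by exact_mod_cast (by omega : 2 * q ≤ n)
  have h2 : (n : ℝ) ≤ 2 * q + 1 := by exact_mod_cast (by omega : n ≤ 2 * q + 1)
  have h3 : (3 : ℝ) ≤ n := by exact_mod_cast hn
  constructor <;> nlinarith

theorem exists_pos_le_of_lt (f : ℕ → ℝ) (hf : ∀ n, 0 < f n) (N : ℕ) :
    ∃ c : ℝ, 0 < c ∧ ∀ n < N, c ≤ f n := by
  induction N with
  | zero => exact ⟨1, one_pos, fun n hn => absurd hn (Nat.not_lt_zero n)⟩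
  | succ N ih =>
    obtain ⟨c, hc, h⟩ := ih
    refine ⟨min c (f N), lt_min hc (hf N), fun n hn => ?_⟩
    rcases Nat.lt_succ_iff_lt_or_eq.1 hn with h1 | rfl
    · exact (min_le_left _ _).trans (h n h1)
    · exact min_le_right _ _

theorem WIAlgorithm.IsPACRankMult.mono {n k : ℕ} {A : WIAlgorithm n k} {ε δ δ' : ℝ}
    (hA : A.IsPACRankMult ε δ) (h : δ ≤ δ') : A.IsPACRankMult ε δ' := fun θ hθ =>
  ⟨(hA θ hθ).1, (ENNReal.ofReal_le_ofReal (by linarith)).trans (hA θ hθ).2⟩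

/-- An algorithm that never errs has infinite sample complexity on some instance. -/
theorem exists_sampleComplexity_eq_top {n k : ℕ} {ε : ℝ} (hn : 3 ≤ n) (hk : 1 ≤ k)
    (h0 : 0 < ε) (h1 : ε ≤ 3 / 8) {A : WIAlgorithm n k} (hA : A.IsPACRankMult ε 0) :
    ∃ ν : Fin n → ℝ, IsInstance ν ∧ A.sampleComplexity ν = ⊤ := by
  obtain ⟨ν, hν, h⟩ := exists_sampleComplexity_ge_of_twoLevelScores hn hk h0 h1 A
    fun θ hθ => (hA θ hθ).1
  refine ⟨ν, hν, by_contra fun hfin => ?_⟩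
  set R := 288000 * (n * ε ^ 2) * (A.sampleComplexity ν).toReal with hR
  have hR0 : 0 ≤ R := by positivity
  have hN1 : (1 : ℝ) ≤ (levelPairs n).card := by
    rw [card_levelPairs]
    exact_mod_cast Nat.mul_pos (by omega) (by omega)
  -- With error probability `exp (-X) ≤ 1 / 2` the two-level bound is at least `X / 2 - 1 = R + 1`,
  -- yet at most `R`.
  set X := 2 * (R + 2) with hX
  have hδ2 : Real.exp (-X) ≤ 1 / 2 := by
    rw [Real.exp_neg, ← one_div]
    refine one_div_le_one_div_of_le (by norm_num) ?_
    have := Real.add_one_le_exp X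
    linarith
  have h2 := h hfin (Real.exp (-X)) (Real.exp_pos _) (by linarith) (hA.mono (Real.exp_pos _).le)
  have h3 : X ≤ Real.log ((levelPairs n).card / Real.exp (-X)) := by
    rw [Real.log_div (by linarith) (Real.exp_pos _).ne', Real.log_exp]
    have := Real.log_nonneg hN1
    linarith
  have h4 : 1 / 2 * X ≤ (1 - Real.exp (-X)) * Real.log ((levelPairs n).card / Real.exp (-X)) :=
    mul_le_mul (by linarith) h3 (by linarith) (by linarith)
  have h5 : 1 * (R + 1) ≤ (levelPairs n).card *
      ((1 - Real.exp (-X)) * Real.log ((levelPairs n).card / Real.exp (-X)) - 1) :=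
    mul_le_mul hN1 (by linarith) (by linarith) (by linarith)
  linarith

/-- The lower bound for a positive error probability, in real numbers. -/
theorem exists_sampleComplexity_ge {δ₀ : ℝ} (hδ₀ : δ₀ < 1) :
    ∃ c : ℝ, 0 < c ∧ ∀ (n k : ℕ), 3 ≤ n → 1 < (n ! : ℝ) * (1 - δ₀) → 1 ≤ k →
      ∀ (ε δ : ℝ), 0 < ε → ε ≤ 3 / 8 → 0 < δ → δ ≤ δ₀ →
      ∀ A : WIAlgorithm n k, A.IsPACRankMult ε δ →
        ∃ ν : Fin n → ℝ, IsInstance ν ∧ (A.sampleComplexity ν ≠ ⊤ →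
          c * (n / ε ^ 2) * Real.log (n / (4 * δ)) ≤ (A.sampleComplexity ν).toReal) := by
  have hpos : 0 < 1 - δ₀ := by linarith
  -- Beyond this threshold for `log (N / δ)` the `-1` costs at most half of the main term; below it,
  -- `n ≤ 4 * N < 4 * exp x₀`.
  set x₀ := 2 / (1 - δ₀) with hx₀
  have hx₀0 : 0 < x₀ := by positivity
  obtain ⟨n₁, hn₁⟩ := exists_nat_gt (4 * Real.exp x₀)
  have hn₁0 : (0 : ℝ) < n₁ := (by positivity : (0 : ℝ) < 4 * Real.exp x₀).trans hn₁
  set γ : ℕ → ℝ := fun n => 1 - δ₀ - 1 / (n ! : ℝ) with hγ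
  obtain ⟨c', hc', hle⟩ := exists_pos_le_of_lt
    (fun n => if 0 < n ∧ 0 < γ n then γ n ^ 2 / 4 / ((4 * n) ^ 2 / ((1 / 7) ^ n) ^ 3) else 1)
    (fun n => by
      split_ifs with h
      · have h1 : (0 : ℝ) < n := by exact_mod_cast h.1
        have h2 := h.2
        positivity
      · exact one_pos) n₁
  -- `3456000 = 288000 * 6 * 2`, from `N ≥ n ^ 2 / 6` and the halved main term. The second entry
  -- serves `n < n₁`, where `n * y ≤ n₁ * x₀`.
  refine ⟨min ((1 - δ₀) / 3456000) (c' / (n₁ * x₀)), lt_min (by positivity) (by positivity), ?_⟩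
  intro n k hn hfac hk ε δ h0 h1 hδ hδδ₀ A hA
  have hn0 : (0 : ℝ) < n := by exact_mod_cast (by omega : 0 < n)
  have hε2 : 0 < ε ^ 2 := by positivity
  obtain ⟨hN6, hN4⟩ := sq_le_card_levelPairs hn
  set N : ℝ := ((levelPairs n).card : ℝ) with hN
  have hN0 : 0 < N := by linarith
  set y := Real.log (n / (4 * δ)) with hy
  set c := min ((1 - δ₀) / 3456000) (c' / (n₁ * x₀)) with hc
  have hc0 : 0 < c := lt_min (by positivity) (by positivity)
  have hyx : y ≤ Real.log (N / δ) := by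
    refine Real.log_le_log (by positivity) ?_
    rw [div_le_div_iff₀ (by positivity) hδ]
    nlinarith
  rcases le_or_gt x₀ (Real.log (N / δ)) with hx | hx
  · obtain ⟨ν, hν, h⟩ := exists_sampleComplexity_ge_of_twoLevelScores hn hk h0 h1 A
      fun θ hθ => (hA θ hθ).1
    refine ⟨ν, hν, fun hfin => ?_⟩
    have h2 := h hfin δ hδ (by linarith) hA
    set x := Real.log (N / δ) with hxdef
    set τ := (A.sampleComplexity ν).toReal with hτ
    have h3 : 2 ≤ (1 - δ₀) * x := by
      rw [hx₀, div_le_iff₀ hpos] at hx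
      linarith
    have h4 : (1 - δ₀) * x / 2 ≤ (1 - δ) * x - 1 := by
      have : (1 - δ₀) * x ≤ (1 - δ) * x :=
        mul_le_mul_of_nonneg_right (by linarith) (hx₀0.le.trans hx)
      linarith
    have h5 : (n : ℝ) ^ 2 / 6 * ((1 - δ₀) * x / 2) ≤ 288000 * (n * ε ^ 2) * τ :=
      (mul_le_mul hN6 h4 (by linarith) hN0.le).trans h2
    have h6 : c * (n / ε ^ 2) * y ≤ c * (n / ε ^ 2) * x :=
      mul_le_mul_of_nonneg_left hyx (by positivity)
    have h7 : c * (n / ε ^ 2) * x ≤ (1 - δ₀) / 3456000 * (n / ε ^ 2) * x :=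
      mul_le_mul_of_nonneg_right (mul_le_mul_of_nonneg_right (min_le_left _ _) (by positivity))
        (hx₀0.le.trans hx)
    refine h6.trans (h7.trans ?_)
    have h8 : (n : ℝ) * ((1 - δ₀) / 3456000 * n * x) ≤ n * (ε ^ 2 * τ) := by
      linarith
    have h9 := le_of_mul_le_mul_left h8 hn0
    rw [show (1 - δ₀) / 3456000 * (n / ε ^ 2) * x = ((1 - δ₀) / 3456000 * n * x) / ε ^ 2 by ring,
      div_le_iff₀ hε2]
    linarith
  · have hnlt : n < n₁ := by
      have h2 : N / δ < Real.exp x₀ := (Real.log_lt_iff_lt_exp (by positivity)).1 hx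
      have h3 : N ≤ N / δ := le_div_self hN0.le hδ (by linarith)
      exact_mod_cast (by linarith : (n : ℝ) < n₁)
    have hfac0 : (0 : ℝ) < n ! := by exact_mod_cast Nat.factorial_pos n
    -- This is the condition `n ! * (1 - δ₀) > 1`.
    have hγn : 0 < γ n := by
      have : 1 / (n ! : ℝ) < 1 - δ₀ := by
        rw [div_lt_iff₀ hfac0]
        linarith
      simp only [hγ]
      linarith
    obtain ⟨ν, hν, h⟩ := exists_sampleComplexity_ge_of_geometricScores (δ := δ) (γ := γ n)
      (by omega) hk h0 h1 hδ.le hγn.le (by simp only [hγ]; linarith) hA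
    refine ⟨ν, hν, fun hfin => ?_⟩
    have h2 := h hfin
    set τ := (A.sampleComplexity ν).toReal with hτ
    have h3 := hle n hnlt
    simp only [if_pos (⟨by omega, hγn⟩ : 0 < n ∧ 0 < γ n)] at h3
    have h4 : c' ≤ ε ^ 2 * τ := by
      refine h3.trans ?_
      rw [div_le_iff₀ (by positivity)]
      refine h2.trans (le_of_eq ?_)
      ring
    have h5 : (n : ℝ) * y ≤ n₁ * x₀ := by
      have e1 : (n : ℝ) * y ≤ n * x₀ := mul_le_mul_of_nonneg_left (hyx.trans hx.le) hn0.le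
      have e2 : (n : ℝ) * x₀ ≤ n₁ * x₀ :=
        mul_le_mul_of_nonneg_right (by exact_mod_cast hnlt.le) hx₀0.le
      exact e1.trans e2
    have h6 : c * (n * y) ≤ c' := by
      calc c * (n * y) ≤ c * (n₁ * x₀) := mul_le_mul_of_nonneg_left h5 hc0.le
        _ ≤ c' / (n₁ * x₀) * (n₁ * x₀) :=
          mul_le_mul_of_nonneg_right (min_le_right _ _) (by positivity)
        _ = c' := div_mul_cancel₀ _ (by positivity)
    rw [show c * (n / ε ^ 2) * y = (c * (n * y)) / ε ^ 2 by ring, div_le_iff₀ hε2]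
    linarith

end PLRank

end

theorem mainTheorem6 (δ₀ : ℝ) (hδ₀ : δ₀ < 1) :
    ∃ c : ℝ, 0 < c ∧
      ∀ (n k : ℕ), 3 ≤ n → 1 < (n ! : ℝ) * (1 - δ₀) → 1 ≤ k → k ≤ n →
      ∀ (ε δ : ℝ), 0 < ε → ε ≤ 1 / Real.sqrt 8 → 0 ≤ δ → δ ≤ δ₀ →
      ∀ A : PLRank.WIAlgorithm n k, A.IsPACRankMult ε δ → A.IsSymmetric →
        ∃ ν : Fin n → ℝ, PLRank.IsInstance ν ∧
          ((c * ((n : ℝ) / ε ^ 2) : ℝ) : EReal) *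
              ENNReal.log ((n : ℝ≥0∞) / (4 * ENNReal.ofReal δ))
            ≤ (A.sampleComplexity ν : EReal) := by
  obtain ⟨c, hc, h⟩ := PLRank.exists_sampleComplexity_ge hδ₀
  refine ⟨c, hc, ?_⟩
  intro n k hn hfac hk _ ε δ h0 h1 hδ hδδ₀ A hA _
  have hε : ε ≤ 3 / 8 := by
    refine h1.trans ?_
    rw [div_le_iff₀ (by positivity)]
    have h2 : (8 / 3 : ℝ) ≤ Real.sqrt 8 := Real.le_sqrt_of_sq_le (by norm_num)
    linarith
  -- For `δ = 0` the bound is infinite, so an instance of infinite sample complexity is needed.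
  rcases hδ.eq_or_lt with rfl | hδ0
  · obtain ⟨ν, hν, htop⟩ := PLRank.exists_sampleComplexity_eq_top hn hk h0 hε hA
    exact ⟨ν, hν, by simp [htop]⟩
  · obtain ⟨ν, hν, hle⟩ := h n k hn hfac hk ε δ h0 hε hδ0 hδδ₀ A hA
    refine ⟨ν, hν, ?_⟩
    by_cases hfin : A.sampleComplexity ν = ⊤
    · simp [hfin]
    · have hn0 : (0 : ℝ) < n := by exact_mod_cast (by omega : 0 < n)
      have hcast : (n : ℝ≥0∞) / (4 * ENNReal.ofReal δ) = ENNReal.ofReal (n / (4 * δ)) := by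
        rw [ENNReal.ofReal_div_of_pos (by positivity), ENNReal.ofReal_mul (by norm_num)]
        simp
      rw [hcast, ENNReal.log_ofReal_of_pos (by positivity), ← EReal.coe_mul,
        ← EReal.coe_toReal (x := (A.sampleComplexity ν : EReal)) (by simpa using hfin) (by simp),
        EReal.coe_le_coe_iff, EReal.toReal_coe_ennreal]
      exact hle hfin
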